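/- Let $r=2^2/3^3=4/27$, and let $(s,c)$ be the (unique) pair of holomorphic functions on the disc $|z|<r$ that satisfies $s'=c^3$, $c'=-s^3$, $s(0)=0$, $c(0)=1$. Then for all complex $z$ with $|z|<r$, $$s(z)\,c(z)=\tfrac{1}{\sqrt2}\,\mathrm{sl}(\sqrt2\,z)=\tfrac12\,\mathrm{sd}(2z).$$ Here $\mathrm{sl}$ is Gauss's lemniscatic sine, the meromorphic function on $\mathbb{C}$ that near $0$ is the inverse of $w\mapsto\int_0^w\frac{dt}{\sqrt{1-t^4}}$, and $\mathrm{sd}=\mathrm{sn}/\mathrm{dn}$ is the Glaisher quotient of the Jacobian elliptic functions with modulus $k=1/\sqrt2$: $\mathrm{sn}$ is the meromorphic function on $\mathbb{C}$ that near $0$ is the inverse of $w\mapsto\int_0^w\frac{dt}{\sqrt{(1-t^2)(1-k^2t^2)}}$, and $\mathrm{dn}$ is the meromorphic function on $\mathbb{C}$ with $\mathrm{dn}^2=1-k^2\,\mathrm{sn}^2$ and $\mathrm{dn}(0)=1$. -/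

import Mathlib

/-- The pair `(s, c)` is a holomorphic solution on the open set `U` (containing `0`) of the
initial value problem `s' = c ^ 3`, `c' = - s ^ 3`, `s 0 = 0`, `c 0 = 1`. -/
structure IsCubicSolutionOn (s c : ℂ → ℂ) (U : Set ℂ) : Prop where
  deriv_s : ∀ z ∈ U, HasDerivAt s (c z ^ 3) z
  deriv_c : ∀ z ∈ U, HasDerivAt c (-(s z ^ 3)) z
  s_zero : s 0 = 0
  c_zero : c 0 = 1

/-- The integral of `φ` along the straight segment from `0` to `w` in the complex plane. -/
noncomputable def segmentIntegral (φ : ℂ → ℂ) (w : ℂ) : ℂ :=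
  ∫ t in (0 : ℝ)..1, w * φ ((t : ℂ) * w)

/-- The meromorphic continuation to `ℂ` of (the germ at `0` of) the function `f`.
It is unique if it exists, since functions in meromorphic normal form (equal to their analytic
value at regular points and removable singularities, and to `0` at poles) that agree near `0`
agree everywhere. If there is none, the function `f` is left as it is. -/
noncomputable def meromorphicContinuation (f : ℂ → ℂ) : ℂ → ℂ :=
  open Classical in
  if h : ∃ g : ℂ → ℂ, MeromorphicNFOn g Set.univ ∧ g =ᶠ[nhds 0] f then h.choose else f

/-- The lemniscatic integral `∫₀ʷ dt / √(1 - t⁴)`, with the principal square root, for `|w| < 1`. -/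
noncomputable def arcsl (w : ℂ) : ℂ :=
  segmentIntegral (fun t => (1 - t ^ 4) ^ (-(1 / 2) : ℂ)) w

/-- Gauss's lemniscatic sine: the meromorphic function on `ℂ` that arises by inversion of the
lemniscatic integral. (On the open unit disc this integral is injective, as its derivative has
positive real part there.) -/
noncomputable def sl : ℂ → ℂ :=
  meromorphicContinuation (Function.invFunOn arcsl (Metric.ball 0 1))

/-- Legendre's elliptic integral of the first kind with modulus `k ∈ (0, 1)`,
`∫₀ʷ dt / (√(1 - t²) √(1 - k² t²))`, with the principal square roots, for `|w| < 1`. -/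
noncomputable def ellipticIntegralF (k : ℝ) (w : ℂ) : ℂ :=
  segmentIntegral
    (fun t => (1 - t ^ 2) ^ (-(1 / 2) : ℂ) * (1 - (k : ℂ) ^ 2 * t ^ 2) ^ (-(1 / 2) : ℂ)) w

/-- The Jacobian elliptic function `sn` with modulus `k ∈ (0, 1)`: the meromorphic function on `ℂ`
that arises by inversion of the elliptic integral of the first kind. (On the open unit disc this
integral is injective, as its derivative has positive real part there.) -/
noncomputable def jacobiSn (k : ℝ) : ℂ → ℂ :=
  meromorphicContinuation (Function.invFunOn (ellipticIntegralF k) (Metric.ball 0 1))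

/-- The Jacobian elliptic function `dn` with modulus `k ∈ (0, 1)`: the meromorphic function on `ℂ`
with `dn² = 1 - k² sn²` and `dn 0 = 1`. -/
noncomputable def jacobiDn (k : ℝ) : ℂ → ℂ :=
  meromorphicContinuation (fun u => (1 - (k : ℂ) ^ 2 * jacobiSn k u ^ 2) ^ (1 / 2 : ℂ))

/-- Glaisher's quotient `sd = sn / dn` with modulus `k ∈ (0, 1)`, as a meromorphic function on `ℂ`
(the continuation of the quotient from a neighbourhood of `0` also gives the right values at the
common poles of `sn` and `dn`, where the quotient has removable singularities). -/
noncomputable def jacobiSd (k : ℝ) : ℂ → ℂ :=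
  meromorphicContinuation (fun u => jacobiSn k u / jacobiDn k u)

/-! The system conserves `c ^ 4 + s ^ 4 = 1`, so `(s c)' = c ^ 4 - s ^ 4` has square `1 - 4 (s c) ^
4`. With `κ = √2`, the function `p v = κ s (κ v / 2) c (κ v / 2)` therefore satisfies `p' ^ 2 = 1 -
p ^ 4`, `p 0 = 0`, `p' 0 = 1`: it inverts the lemniscatic integral near `0` (`isLemniscateGerm`,
`invFunOn_arcsl`).

What remains is global. The duplication formula doubles the radius of any disc to which the germ `p`
extends meromorphically, so `sl` exists on the plane with germ `p`. For `k = 1 / √2`, `sn` and `dn`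
are rational in `p` and `p'` at `κ u / 4`, and their quotient is `κ p (κ u / 2)`, again by
duplication. The identity theorem for meromorphic functions in normal form carries both germ
identities to the whole disc, poles included. -/

open Set Filter Metric Topology

/-! ### Local inversion of integrals -/

/-- A holomorphic function on a convex set whose derivative has positive real part is injective. -/
theorem injOn_of_convex_of_re_deriv_pos {f f' : ℂ → ℂ} {U : Set ℂ} (hU : Convex ℝ U)
    (hf : ∀ z ∈ U, HasDerivAt f (f' z) z) (hpos : ∀ z ∈ U, 0 < (f' z).re) : InjOn f U := by
  intro a ha b hb hab
  by_contra hne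
  have hmem : ∀ t ∈ Icc (0 : ℝ) 1, a + (t : ℂ) * (b - a) ∈ U := fun t ht => by
    simpa using hU.add_smul_sub_mem ha hb ht
  have hd : ∀ t ∈ Icc (0 : ℝ) 1, HasDerivAt
      (fun t : ℝ => ((starRingEnd ℂ (b - a)) * f (a + (t : ℂ) * (b - a))).re)
      ((starRingEnd ℂ (b - a)) * (f' (a + (t : ℂ) * (b - a)) * (b - a))).re t := by
    intro t ht
    have h1 : HasDerivAt (fun t : ℂ => a + t * (b - a)) (b - a) (t : ℂ) := by
      simpa using ((hasDerivAt_id (t : ℂ)).mul_const (b - a)).const_add a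
    -- The factor `conj (b - a)` turns the derivative along the segment into `|b - a| ^ 2 * f'`,
    -- whose real part is positive.
    have h2 := ((hf _ (hmem t ht)).comp (t : ℂ) h1).const_mul (starRingEnd ℂ (b - a))
    exact h2.real_of_complex
  have hmono := strictMonoOn_of_deriv_pos (convex_Icc (0 : ℝ) 1)
    (fun t ht => (hd t ht).continuousAt.continuousWithinAt) (fun t ht => by
      rw [interior_Icc] at ht
      have ht' := Ioo_subset_Icc_self ht
      rw [(hd t ht').deriv]
      have : (starRingEnd ℂ (b - a)) * (f' (a + (t : ℂ) * (b - a)) * (b - a))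
          = (Complex.normSq (b - a) : ℂ) * f' (a + (t : ℂ) * (b - a)) := by
        rw [Complex.normSq_eq_conj_mul_self]; ring
      rw [this, Complex.re_ofReal_mul]
      exact mul_pos (Complex.normSq_pos.2 (sub_ne_zero.2 (Ne.symm hne))) (hpos _ (hmem t ht')))
  have := hmono (left_mem_Icc.2 zero_le_one) (right_mem_Icc.2 zero_le_one) zero_lt_one
  simp [hab] at this

theorem segmentIntegral_eq_sub {φ Φ : ℂ → ℂ} {r : ℝ}
    (hΦ : ∀ z ∈ ball (0 : ℂ) r, HasDerivAt Φ (φ z) z) (hφ : ContinuousOn φ (ball 0 r))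
    {w : ℂ} (hw : w ∈ ball (0 : ℂ) r) : segmentIntegral φ w = Φ w - Φ 0 := by
  have hmem : ∀ t ∈ uIcc (0 : ℝ) 1, (t : ℂ) * w ∈ ball (0 : ℂ) r := by
    intro t ht
    rw [uIcc_of_le zero_le_one] at ht
    rw [mem_ball_zero_iff] at hw ⊢
    rw [norm_mul, Complex.norm_real, Real.norm_of_nonneg ht.1]
    exact (mul_le_of_le_one_left (norm_nonneg _) ht.2).trans_lt hw
  have hd : ∀ t ∈ uIcc (0 : ℝ) 1,
      HasDerivAt (fun t : ℝ => Φ ((t : ℂ) * w)) (w * φ ((t : ℂ) * w)) t := by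
    intro t ht
    have h1 : HasDerivAt (fun t : ℂ => t * w) w (t : ℂ) := by
      simpa using (hasDerivAt_id (t : ℂ)).mul_const w
    have h2 := ((hΦ _ (hmem t ht)).comp (t : ℂ) h1).comp_ofReal
    rwa [mul_comm] at h2
  have hc : ContinuousOn (fun t : ℝ => w * φ ((t : ℂ) * w)) (uIcc 0 1) :=
    continuousOn_const.mul (hφ.comp (by fun_prop) hmem)
  simpa [segmentIntegral] using intervalIntegral.integral_eq_sub_of_hasDerivAt hd hc.intervalIntegrable

/-- Inverting the integral of `φ` amounts to solving `φ(p) p' = 1` with `p(0) = 0`. -/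
theorem invFunOn_segmentIntegral_eventuallyEq {φ p p' : ℂ → ℂ}
    (hφ : DifferentiableOn ℂ φ (ball 0 1)) (hpos : ∀ z ∈ ball (0 : ℂ) 1, 0 < (φ z).re)
    (hp : ∀ᶠ v in 𝓝 0, HasDerivAt p (p' v) v) (hp0 : p 0 = 0)
    (hode : ∀ᶠ v in 𝓝 0, φ (p v) * p' v = 1) :
    Function.invFunOn (segmentIntegral φ) (ball 0 1) =ᶠ[𝓝 0] p := by
  obtain ⟨Φ, hΦ⟩ := hφ.isExactOn_ball
  have hseg : EqOn (segmentIntegral φ) (fun w => Φ w - Φ 0) (ball 0 1) :=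
    fun w hw => segmentIntegral_eq_sub hΦ hφ.continuousOn hw
  have hinj : InjOn (segmentIntegral φ) (ball 0 1) := by
    have : InjOn (fun w => Φ w - Φ 0) (ball (0 : ℂ) 1) :=
      injOn_of_convex_of_re_deriv_pos (convex_ball _ _) (fun z hz => (hΦ z hz).sub_const _) hpos
    exact this.congr hseg.symm
  have hpc : ContinuousAt p 0 := hp.self_of_nhds.continuousAt
  have hpb : ∀ᶠ v in 𝓝 0, p v ∈ ball (0 : ℂ) 1 :=
    hpc.eventually_mem (by rw [hp0]; exact ball_mem_nhds _ one_pos)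
  obtain ⟨ε, hε, h⟩ := Metric.eventually_nhds_iff_ball.1 (hp.and (hode.and hpb))
  -- By the equation `φ (p) p' = 1`, the derivative of `Φ ∘ p - id` vanishes.
  have key : EqOn (fun v => Φ (p v) - v) (fun _ => Φ 0) (ball 0 ε) := by
    have hd : ∀ v ∈ ball (0 : ℂ) ε, HasDerivAt (fun v => Φ (p v) - v) 0 v := by
      intro v hv
      obtain ⟨h1, h2, h3⟩ := h v hv
      have := ((hΦ _ h3).comp v h1).sub (hasDerivAt_id v)
      rw [h2, sub_self] at this
      exact this
    intro v hv
    have := (convex_ball (0 : ℂ) ε).is_const_of_fderivWithin_eq_zero (𝕜 := ℂ)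
      (f := fun v => Φ (p v) - v)
      (fun v hv => (hd v hv).differentiableAt.differentiableWithinAt) (fun v hv => by
        rw [fderivWithin_of_isOpen isOpen_ball hv]
        ext; simp [(hd v hv).deriv]) hv (mem_ball_self hε)
    simpa [hp0] using this
  filter_upwards [ball_mem_nhds _ hε] with v hv
  have hv1 : segmentIntegral φ (p v) = v := by
    rw [hseg (h v hv).2.2]
    have := key hv
    simp only at this ⊢
    linear_combination this
  have := hinj.leftInvOn_invFunOn (h v hv).2.2
  rwa [hv1] at this

theorem eventually_eq_one_of_sq_eq_one {h : ℂ → ℂ} (hc : ContinuousAt h 0) (h0 : h 0 = 1)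
    (hsq : ∀ᶠ v in 𝓝 0, h v ^ 2 = 1) : ∀ᶠ v in 𝓝 0, h v = 1 := by
  have : ∀ᶠ v in 𝓝 0, h v ≠ -1 := hc.eventually_ne (by rw [h0]; norm_num)
  filter_upwards [this, hsq] with v h1 h2
  exact (sq_eq_sq_iff_eq_or_eq_neg.1 (h2.trans (one_pow 2).symm)).resolve_right h1

theorem cpow_neg_half_sq (x : ℂ) : (x ^ (-(1 / 2) : ℂ)) ^ 2 = x⁻¹ := by
  rw [← Complex.cpow_nat_mul]; norm_num [Complex.cpow_neg_one]

/-- Both arguments lie in `(-π/2, π/2)`, hence so does minus half their sum, the argument of the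
product. -/
theorem re_cpow_neg_half_mul_pos {x y : ℂ} (hx : 0 < x.re) (hy : 0 < y.re) :
    0 < (x ^ (-(1 / 2) : ℂ) * y ^ (-(1 / 2) : ℂ)).re := by
  have hx0 : x ≠ 0 := by rintro rfl; simp at hx
  have hy0 : y ≠ 0 := by rintro rfl; simp at hy
  rw [Complex.cpow_def_of_ne_zero hx0, Complex.cpow_def_of_ne_zero hy0, ← Complex.exp_add,
    Complex.exp_re]
  have h1 := abs_lt.1 (Complex.abs_arg_lt_pi_div_two_iff.2 (.inl hx))
  have h2 := abs_lt.1 (Complex.abs_arg_lt_pi_div_two_iff.2 (.inl hy))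
  have him : (Complex.log x * -(1 / 2) + Complex.log y * -(1 / 2)).im
      = -(x.arg + y.arg) / 2 := by
    simp [Complex.add_im, Complex.mul_im, Complex.log_im]; ring
  rw [him]
  exact mul_pos (Real.exp_pos _) (Real.cos_pos_of_mem_Ioo ⟨by linarith, by linarith⟩)

theorem re_cpow_neg_half_pos {x : ℂ} (hx : 0 < x.re) : 0 < (x ^ (-(1 / 2) : ℂ)).re := by
  simpa using re_cpow_neg_half_mul_pos hx (y := 1) (by simp)

theorem re_one_sub_pos {x : ℂ} (hx : ‖x‖ < 1) : 0 < (1 - x).re := by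
  have := (Complex.re_le_norm x).trans_lt hx
  simpa using this

/-! ### Meromorphic continuation -/

/-- Identity theorem for meromorphic functions in normal form. -/
theorem MeromorphicNFOn.eqOn_of_eventuallyEq {f g : ℂ → ℂ} {U : Set ℂ} {x : ℂ}
    (hf : MeromorphicNFOn f U) (hg : MeromorphicNFOn g U) (hU : IsPreconnected U) (hx : x ∈ U)
    (h : f =ᶠ[𝓝 x] g) : EqOn f g U := by
  intro y hy
  have hm : MeromorphicOn (f - g) U := hf.meromorphicOn.sub hg.meromorphicOn
  have hxt : meromorphicOrderAt (f - g) x = ⊤ := by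
    rw [meromorphicOrderAt_eq_top_iff]
    filter_upwards [h.filter_mono nhdsWithin_le_nhds] with z hz
    simp [hz]
  have hyt : meromorphicOrderAt (f - g) y = ⊤ := by
    by_contra hne
    exact hm.meromorphicOrderAt_ne_top_of_isPreconnected hU hy hx hne hxt
  rw [meromorphicOrderAt_eq_top_iff] at hyt
  have : f =ᶠ[𝓝[≠] y] g := by
    filter_upwards [hyt] with z hz
    simpa [sub_eq_zero] using hz
  exact (((hf hy).eventuallyEq_nhdsNE_iff_eventuallyEq_nhds (hg hy)).1 this).self_of_nhds

/-- Normalisation could change the value at `0`; analyticity there rules this out, so the germ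
survives. -/
theorem exists_meromorphicNFOn_eventuallyEq {g : ℂ → ℂ} {U : Set ℂ} (hU : (0 : ℂ) ∈ U)
    (hg : MeromorphicOn g U) (ha : AnalyticAt ℂ g 0) :
    ∃ G, MeromorphicNFOn G U ∧ G =ᶠ[𝓝 0] g := by
  refine ⟨toMeromorphicNFOn g U, meromorphicNFOn_toMeromorphicNFOn g U, ?_⟩
  exact ((meromorphicNFOn_toMeromorphicNFOn g U
    hU).eventuallyEq_nhdsNE_iff_eventuallyEq_nhds ha.meromorphicNFAt).1
    (hg.toMeromorphicNFOn_eq_self_on_nhdsNE hU)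

theorem meromorphicContinuation_spec {f g : ℂ → ℂ} (hg : MeromorphicOn g univ)
    (ha : AnalyticAt ℂ g 0) (h : g =ᶠ[𝓝 0] f) :
    MeromorphicNFOn (meromorphicContinuation f) univ ∧ meromorphicContinuation f =ᶠ[𝓝 0] f := by
  obtain ⟨G, hG, hGg⟩ := exists_meromorphicNFOn_eventuallyEq (mem_univ _) hg ha
  have hex : ∃ g : ℂ → ℂ, MeromorphicNFOn g univ ∧ g =ᶠ[𝓝 0] f := ⟨G, hG, hGg.trans h⟩
  rw [meromorphicContinuation, dif_pos hex]
  exact hex.choose_spec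

/-- A germ that extends meromorphically to arbitrarily large disks extends to the plane. -/
theorem exists_meromorphicOn_univ_of_balls {p : ℂ → ℂ} (ha : AnalyticAt ℂ p 0)
    (h : ∀ R : ℝ, ∃ g : ℂ → ℂ, MeromorphicOn g (ball 0 R) ∧ g =ᶠ[𝓝 0] p) :
    ∃ g : ℂ → ℂ, MeromorphicOn g univ ∧ g =ᶠ[𝓝 0] p := by
  have h' : ∀ n : ℕ, ∃ g : ℂ → ℂ, MeromorphicNFOn g (ball 0 (n + 1 : ℝ)) ∧ g =ᶠ[𝓝 0] p := by
    intro n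
    obtain ⟨g, hg, hgp⟩ := h (n + 1)
    obtain ⟨G, hG, hGg⟩ := exists_meromorphicNFOn_eventuallyEq
      (mem_ball_self (by positivity)) hg (ha.congr hgp.symm)
    exact ⟨G, hG, hGg.trans hgp⟩
  choose G hG hGp using h'
  have hmono : ∀ {m n : ℕ}, m ≤ n → EqOn (G m) (G n) (ball 0 (m + 1 : ℝ)) := by
    intro m n hmn
    have hsub : ball (0 : ℂ) (m + 1 : ℝ) ⊆ ball 0 (n + 1 : ℝ) :=
      ball_subset_ball (by gcongr)
    exact (hG m).eqOn_of_eventuallyEq (fun z hz => hG n (hsub hz))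
      (convex_ball _ _).isPreconnected (mem_ball_self (by positivity)) ((hGp m).trans (hGp n).symm)
  -- The extensions agree on common discs, and `‖z‖ < ⌊‖z‖⌋₊ + 1` puts `z` in the disc of the one
  -- selected.
  set g : ℂ → ℂ := fun z => G ⌊‖z‖⌋₊ z with hgdef
  have hgG : ∀ n : ℕ, EqOn (G n) g (ball 0 (n + 1 : ℝ)) := by
    intro n z hz
    rw [mem_ball_zero_iff] at hz
    have hle : ⌊‖z‖⌋₊ ≤ n := by
      rw [← Nat.lt_add_one_iff, Nat.floor_lt (norm_nonneg _)]
      exact_mod_cast hz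
    exact (hmono hle (by rw [mem_ball_zero_iff]; exact Nat.lt_floor_add_one _)).symm
  refine ⟨g, fun z _ => ?_, ?_⟩
  · exact (hG ⌊‖z‖⌋₊).meromorphicOn.congr (hgG _) isOpen_ball z
      (by rw [mem_ball_zero_iff]; exact Nat.lt_floor_add_one _)
  · refine EventuallyEq.trans ?_ (hGp 0)
    filter_upwards [ball_mem_nhds (0 : ℂ) (show (0 : ℝ) < (0 : ℕ) + 1 by norm_num)] with z hz
    exact (hgG 0 hz).symm

/-! ### Rescaling, and germs of the two elliptic integrals' inverses -/

theorem eventually_comp_mul {P : ℂ → Prop} (h : ∀ᶠ v in 𝓝 0, P v) (k : ℂ) :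
    ∀ᶠ u in 𝓝 0, P (k * u) := by
  have : Tendsto (fun u : ℂ => k * u) (𝓝 0) (𝓝 0) := by
    have : ContinuousAt (fun u : ℂ => k * u) 0 := by fun_prop
    simpa [ContinuousAt] using this
  exact this.eventually h

theorem HasDerivAt.comp_const_mul {f : ℂ → ℂ} {f' k u : ℂ} (h : HasDerivAt f f' (k * u)) :
    HasDerivAt (fun u => f (k * u)) (k * f') u := by
  have h1 : HasDerivAt (fun u : ℂ => k * u) k u := by
    simpa using (hasDerivAt_id u).const_mul k
  have := h.comp u h1
  rwa [mul_comm] at this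

theorem AnalyticAt.comp_const_mul {f : ℂ → ℂ} (h : AnalyticAt ℂ f 0) (k : ℂ) :
    AnalyticAt ℂ (fun u => f (k * u)) 0 :=
  AnalyticAt.fun_comp (g := f) (f := fun u => k * u) (by simpa using h) (by fun_prop)

theorem MeromorphicOn.comp_const_mul {f : ℂ → ℂ} {U V : Set ℂ} (h : MeromorphicOn f U) {k : ℂ}
    (hV : MapsTo (fun u => k * u) V U) : MeromorphicOn (fun u => f (k * u)) V :=
  fun u hu => (h _ (hV hu)).comp_analyticAt (g := fun u => k * u) (by fun_prop)

/-- Settles the sign of the square root: by continuity the product stays near its value `1` at `0`,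
away from `-1`. -/
theorem eventually_mul_eq_one_of_sq {φ p b : ℂ → ℂ} (hφ : ContinuousAt φ 0) (hφ0 : φ 0 = 1)
    (hp : ContinuousAt p 0) (hp0 : p 0 = 0) (hb : ContinuousAt b 0) (hb0 : b 0 = 1)
    (hsq : ∀ᶠ v in 𝓝 0, φ (p v) ^ 2 * b v ^ 2 = 1) : ∀ᶠ v in 𝓝 0, φ (p v) * b v = 1 := by
  refine eventually_eq_one_of_sq_eq_one ?_ (by simp [hp0, hφ0, hb0]) ?_
  · exact (ContinuousAt.comp (by rwa [hp0]) hp).mul hb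
  · filter_upwards [hsq] with v hv
    rw [mul_pow, hv]

theorem invFunOn_arcsl_eventuallyEq {p b : ℂ → ℂ} (hp : ∀ᶠ v in 𝓝 0, HasDerivAt p (b v) v)
    (hp0 : p 0 = 0) (hb : ContinuousAt b 0) (hb0 : b 0 = 1)
    (hsq : ∀ᶠ v in 𝓝 0, b v ^ 2 = 1 - p v ^ 4) :
    Function.invFunOn arcsl (ball 0 1) =ᶠ[𝓝 0] p := by
  have hre : ∀ z ∈ ball (0 : ℂ) 1, 0 < (1 - z ^ 4).re := fun z hz => by
    rw [mem_ball_zero_iff] at hz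
    refine re_one_sub_pos ?_
    rw [norm_pow]
    exact pow_lt_one₀ (norm_nonneg _) hz (by norm_num)
  have hd : DifferentiableOn ℂ (fun t : ℂ => (1 - t ^ 4) ^ (-(1 / 2) : ℂ)) (ball 0 1) :=
    fun z hz => (DifferentiableAt.cpow_const (f := fun t : ℂ => 1 - t ^ 4) (by fun_prop)
      (.inl (hre z hz))).differentiableWithinAt
  refine invFunOn_segmentIntegral_eventuallyEq hd (fun z hz => re_cpow_neg_half_pos (hre z hz))
    hp hp0 (eventually_mul_eq_one_of_sq (φ := fun t => (1 - t ^ 4) ^ (-(1 / 2) : ℂ)) ?_ ?_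
      hp.self_of_nhds.continuousAt hp0 hb hb0 ?_)
  · exact (hd.differentiableAt (ball_mem_nhds _ one_pos)).continuousAt
  · simp
  · filter_upwards [hsq, hb.eventually_ne (y := 0) (by simp [hb0])] with v h1 h2
    rw [cpow_neg_half_sq, ← h1, inv_mul_cancel₀ (pow_ne_zero 2 h2)]

theorem invFunOn_ellipticIntegralF_eventuallyEq {k : ℝ} (hk : |k| ≤ 1) {p b : ℂ → ℂ}
    (hp : ∀ᶠ v in 𝓝 0, HasDerivAt p (b v) v)
    (hp0 : p 0 = 0) (hb : ContinuousAt b 0) (hb0 : b 0 = 1)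
    (hsq : ∀ᶠ v in 𝓝 0, b v ^ 2 = (1 - p v ^ 2) * (1 - (k : ℂ) ^ 2 * p v ^ 2)) :
    Function.invFunOn (ellipticIntegralF k) (ball 0 1) =ᶠ[𝓝 0] p := by
  have hre1 : ∀ z ∈ ball (0 : ℂ) 1, 0 < (1 - z ^ 2).re := fun z hz => by
    rw [mem_ball_zero_iff] at hz
    refine re_one_sub_pos ?_
    rw [norm_pow]
    exact pow_lt_one₀ (norm_nonneg _) hz (by norm_num)
  have hre2 : ∀ z ∈ ball (0 : ℂ) 1, 0 < (1 - (k : ℂ) ^ 2 * z ^ 2).re := fun z hz => by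
    rw [mem_ball_zero_iff] at hz
    refine re_one_sub_pos ?_
    rw [norm_mul, norm_pow, norm_pow, Complex.norm_real, Real.norm_eq_abs]
    exact mul_lt_one_of_nonneg_of_lt_one_right (pow_le_one₀ (abs_nonneg _) hk) (by positivity)
      (pow_lt_one₀ (norm_nonneg _) hz (by norm_num))
  have hd : DifferentiableOn ℂ (fun t : ℂ => (1 - t ^ 2) ^ (-(1 / 2) : ℂ) *
      (1 - (k : ℂ) ^ 2 * t ^ 2) ^ (-(1 / 2) : ℂ)) (ball 0 1) :=
    fun z hz => ((DifferentiableAt.cpow_const (f := fun t : ℂ => 1 - t ^ 2) (by fun_prop)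
      (.inl (hre1 z hz))).mul
      (DifferentiableAt.cpow_const (f := fun t : ℂ => 1 - (k : ℂ) ^ 2 * t ^ 2)
      (by fun_prop) (.inl (hre2 z hz)))).differentiableWithinAt
  refine invFunOn_segmentIntegral_eventuallyEq hd
    (fun z hz => re_cpow_neg_half_mul_pos (hre1 z hz) (hre2 z hz))
    hp hp0 (eventually_mul_eq_one_of_sq (φ := fun t => (1 - t ^ 2) ^ (-(1 / 2) : ℂ) *
      (1 - (k : ℂ) ^ 2 * t ^ 2) ^ (-(1 / 2) : ℂ)) ?_ ?_ hp.self_of_nhds.continuousAt hp0 hb hb0 ?_)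
  · exact (hd.differentiableAt (ball_mem_nhds _ one_pos)).continuousAt
  · simp
  · filter_upwards [hsq, hb.eventually_ne (y := 0) (by simp [hb0])] with v h1 h2
    rw [mul_pow, cpow_neg_half_sq, cpow_neg_half_sq, ← mul_inv, ← h1,
      inv_mul_cancel₀ (pow_ne_zero 2 h2)]

/-! ### The lemniscatic sine -/

/-- Near `0`, the function `p` solves `p' = b`, `b' = -2 p ^ 3`, `b ^ 2 = 1 - p ^ 4`, `p 0 = 0`,
`b 0 = 1`: it is the germ of the lemniscatic sine. -/
structure IsLemniscateGerm (p b : ℂ → ℂ) : Prop where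
  deriv_p : ∀ᶠ v in 𝓝 0, HasDerivAt p (b v) v
  deriv_b : ∀ᶠ v in 𝓝 0, HasDerivAt b (-2 * p v ^ 3) v
  sq : ∀ᶠ v in 𝓝 0, b v ^ 2 = 1 - p v ^ 4
  p_zero : p 0 = 0
  b_zero : b 0 = 1

namespace IsLemniscateGerm

variable {p b : ℂ → ℂ}

theorem continuousAt (h : IsLemniscateGerm p b) : ContinuousAt p 0 :=
  h.deriv_p.self_of_nhds.continuousAt

theorem continuousAt_b (h : IsLemniscateGerm p b) : ContinuousAt b 0 :=
  h.deriv_b.self_of_nhds.continuousAt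

theorem analyticAt (h : IsLemniscateGerm p b) : AnalyticAt ℂ p 0 :=
  Complex.analyticAt_iff_eventually_differentiableAt.2
    (h.deriv_p.mono fun _ hv => hv.differentiableAt)

theorem analyticAt_b (h : IsLemniscateGerm p b) : AnalyticAt ℂ b 0 :=
  Complex.analyticAt_iff_eventually_differentiableAt.2
    (h.deriv_b.mono fun _ hv => hv.differentiableAt)

theorem invFunOn_arcsl (h : IsLemniscateGerm p b) :
    Function.invFunOn arcsl (ball 0 1) =ᶠ[𝓝 0] p :=
  invFunOn_arcsl_eventuallyEq h.deriv_p h.p_zero h.continuousAt_b h.b_zero h.sq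

theorem eventually_ne (h : IsLemniscateGerm p b) : ∀ᶠ v in 𝓝 0, 1 + p v ^ 4 ≠ 0 := by
  have : ContinuousAt (fun v => 1 + p v ^ 4) 0 := by have := h.continuousAt; fun_prop
  exact this.eventually_ne (by simp [h.p_zero])

theorem eventually_ne' (h : IsLemniscateGerm p b) :
    ∀ᶠ v in 𝓝 0, 1 + 2 * p v ^ 2 - p v ^ 4 ≠ 0 := by
  have : ContinuousAt (fun v => 1 + 2 * p v ^ 2 - p v ^ 4) 0 := by
    have := h.continuousAt; fun_prop
  exact this.eventually_ne (by simp [h.p_zero])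

/-- The duplication formula of the lemniscatic sine. -/
theorem duplication (h : IsLemniscateGerm p b) :
    p =ᶠ[𝓝 0] fun v => 2 * p (1 / 2 * v) * b (1 / 2 * v) / (1 + p (1 / 2 * v) ^ 4) := by
  -- The right-hand side also inverts `arcsl` near `0`; the given `b` is its derivative.
  refine h.invFunOn_arcsl.symm.trans (invFunOn_arcsl_eventuallyEq
    (b := fun v => (1 - 6 * p (1 / 2 * v) ^ 4 + p (1 / 2 * v) ^ 8) / (1 + p (1 / 2 * v) ^ 4) ^ 2)
    ?_ (by simp [h.p_zero]) ?_ (by simp [h.p_zero]) ?_)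
  · filter_upwards [eventually_comp_mul h.deriv_p (1 / 2), eventually_comp_mul h.deriv_b (1 / 2),
      eventually_comp_mul h.sq (1 / 2), eventually_comp_mul h.eventually_ne (1 / 2)]
      with v h1 h2 h3 h4
    have hp := h1.comp_const_mul
    have hb := h2.comp_const_mul
    refine (((hp.const_mul 2).mul hb).div ((hp.pow 4).const_add 1) h4).congr_deriv ?_
    simp only [Pi.mul_apply, Pi.pow_apply]
    generalize p (1 / 2 * v) = a at *
    generalize b (1 / 2 * v) = d at *
    congr 1
    push_cast
    linear_combination (1 - 3 * a ^ 4) * h3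
  · have h1 : ContinuousAt (fun v => p (1 / 2 * v)) 0 := (h.analyticAt.comp_const_mul _).continuousAt
    exact ((continuousAt_const.sub (continuousAt_const.mul (h1.pow 4))).add (h1.pow 8)).div₀
      ((continuousAt_const.add (h1.pow 4)).pow 2) (by simp [h.p_zero])
  · filter_upwards [eventually_comp_mul h.sq (1 / 2), eventually_comp_mul h.eventually_ne (1 / 2)]
      with v h3 h4
    generalize p (1 / 2 * v) = a at *
    generalize b (1 / 2 * v) = d at *
    have h5 : d ^ 4 = (1 - a ^ 4) ^ 2 := by rw [← h3]; ring
    rw [div_pow, div_pow, mul_pow, mul_pow, h5]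
    field_simp
    ring

/-- The germ of the lemniscatic sine extends meromorphically to the plane. -/
theorem exists_meromorphicOn_univ (h : IsLemniscateGerm p b) :
    ∃ g : ℂ → ℂ, MeromorphicOn g univ ∧ g =ᶠ[𝓝 0] p := by
  refine exists_meromorphicOn_univ_of_balls h.analyticAt fun R => ?_
  obtain ⟨r, hr, ha⟩ := Metric.eventually_nhds_iff_ball.1 h.analyticAt.eventually_analyticAt
  have key : ∀ n : ℕ, ∃ g : ℂ → ℂ, MeromorphicOn g (ball 0 (2 ^ n * r)) ∧ g =ᶠ[𝓝 0] p := by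
    intro n
    induction n with
    | zero => exact ⟨p, fun z hz => (ha z (by simpa using hz)).meromorphicAt, .rfl⟩
    | succ n ih =>
      obtain ⟨g, hg, hgp⟩ := ih
      -- `deriv g` replaces `b`, so that only `p` has to be continued.
      refine ⟨fun v => 2 * g (1 / 2 * v) * deriv g (1 / 2 * v) / (1 + g (1 / 2 * v) ^ 4), ?_, ?_⟩
      · have hmaps : MapsTo (fun v : ℂ => 1 / 2 * v) (ball 0 (2 ^ (n + 1) * r))
            (ball 0 (2 ^ n * r)) := fun v hv => by
          rw [mem_ball_zero_iff] at hv ⊢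
          rw [norm_mul]
          norm_num
          rw [pow_succ] at hv
          linarith
        have h1 := hg.comp_const_mul hmaps
        have h2 := hg.deriv.comp_const_mul hmaps
        exact (((MeromorphicOn.const 2).mul h1).mul h2).div ((MeromorphicOn.const 1).add (h1.pow 4))
      · refine EventuallyEq.trans ?_ h.duplication.symm
        have hd : deriv g =ᶠ[𝓝 0] b :=
          hgp.deriv.trans (h.deriv_p.mono fun v hv => hv.deriv)
        filter_upwards [eventually_comp_mul hgp (1 / 2), eventually_comp_mul hd (1 / 2)]
          with v h1 h2
        rw [h1, h2]
  obtain ⟨n, hn⟩ := pow_unbounded_of_one_lt (R / r) (one_lt_two (α := ℝ))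
  obtain ⟨g, hg, hgp⟩ := key n
  exact ⟨g, hg.mono_set (ball_subset_ball ((div_lt_iff₀ hr).1 hn).le), hgp⟩

theorem sl_spec (h : IsLemniscateGerm p b) : MeromorphicNFOn sl univ ∧ sl =ᶠ[𝓝 0] p := by
  obtain ⟨g, hg, hgp⟩ := h.exists_meromorphicOn_univ
  obtain ⟨h1, h2⟩ := meromorphicContinuation_spec hg (h.analyticAt.congr hgp.symm)
    (hgp.trans h.invFunOn_arcsl.symm)
  exact ⟨h1, h2.trans h.invFunOn_arcsl⟩

end IsLemniscateGerm

theorem ofReal_sqrt_two_sq : ((Real.sqrt 2 : ℝ) : ℂ) ^ 2 = 2 := by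
  rw [← Complex.ofReal_pow, Real.sq_sqrt (by norm_num)]; norm_num

theorem ofReal_one_div_sqrt_two_sq : ((1 / Real.sqrt 2 : ℝ) : ℂ) ^ 2 = 1 / 2 := by
  rw [Complex.ofReal_div, div_pow, ofReal_sqrt_two_sq]; norm_num

theorem MeromorphicNFOn.comp_const_mul {f : ℂ → ℂ} (h : MeromorphicNFOn f univ) (k : ℂ)
    (U : Set ℂ) : MeromorphicNFOn (fun u => f (k * u)) U := fun u _ =>
  (h (mem_univ (k * u))).comp_analyticAt (g := fun u => k * u) (by fun_prop)

/-! ### Jacobian functions with modulus `1 / √2` -/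

namespace IsLemniscateGerm

variable {p b : ℂ → ℂ}

/-- `sn` with modulus `1 / √2` in terms of the lemniscatic sine of a quarter of `√2 u`. -/
theorem jacobiSn_eventuallyEq (h : IsLemniscateGerm p b) {κ : ℂ} (hκ : κ ^ 2 = 2) :
    jacobiSn (1 / Real.sqrt 2) =ᶠ[𝓝 0] fun u => 2 * κ * p (κ / 4 * u) * b (κ / 4 * u) /
      (1 + 2 * p (κ / 4 * u) ^ 2 - p (κ / 4 * u) ^ 4) := by
  have hpa := h.analyticAt.comp_const_mul (κ / 4)
  have hba := h.analyticAt_b.comp_const_mul (κ / 4)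
  have hinv : Function.invFunOn (ellipticIntegralF (1 / Real.sqrt 2)) (ball 0 1) =ᶠ[𝓝 0]
      fun u => 2 * κ * p (κ / 4 * u) * b (κ / 4 * u) /
      (1 + 2 * p (κ / 4 * u) ^ 2 - p (κ / 4 * u) ^ 4) := by
    -- At `κ u / 2` one would need `dn ^ 2 = 1 / (1 + p ^ 2)`, a square root. Halving once more
    -- makes `1 + p ^ 2` the square of `(1 + 2 a ^ 2 - a ^ 4) / (1 + a ^ 4)`, where `a = p (κ u /
    -- 4)`. The witness `b` is the derivative of the resulting `sn`.
    refine invFunOn_ellipticIntegralF_eventuallyEq (b := fun u =>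
      (1 - 2 * p (κ / 4 * u) ^ 2 - 2 * p (κ / 4 * u) ^ 6 - p (κ / 4 * u) ^ 8) /
        (1 + 2 * p (κ / 4 * u) ^ 2 - p (κ / 4 * u) ^ 4) ^ 2)
      ?_ ?_ (by simp [h.p_zero]) ?_ (by simp [h.p_zero]) ?_
    · rw [abs_of_nonneg (by positivity), div_le_one (by positivity)]
      exact Real.one_le_sqrt.2 (by norm_num)
    · filter_upwards [eventually_comp_mul h.deriv_p (κ / 4),
        eventually_comp_mul h.deriv_b (κ / 4), eventually_comp_mul h.sq (κ / 4),
        eventually_comp_mul h.eventually_ne' (κ / 4)] with v h1 h2 h3 h4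
      have hp := h1.comp_const_mul
      have hb := h2.comp_const_mul
      refine (((hp.const_mul (2 * κ)).mul hb).div
        ((((hp.pow 2).const_mul 2).const_add 1).sub (hp.pow 4)) h4).congr_deriv ?_
      simp only [Pi.mul_apply, Pi.pow_apply, Pi.sub_apply]
      generalize p (κ / 4 * v) = a at *
      generalize b (κ / 4 * v) = d at *
      congr 1
      push_cast
      linear_combination (1 - 2 * a ^ 2 + 3 * a ^ 4) * h3 +
        ((d ^ 2 - 2 * a ^ 4) * (1 + 2 * a ^ 2 - a ^ 4) / 2 - 2 * a ^ 2 * (1 - a ^ 2) * d ^ 2) * hκ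
    · have hc := hpa.continuousAt
      exact (((continuousAt_const.sub (continuousAt_const.mul (hc.pow 2))).sub
        (continuousAt_const.mul (hc.pow 6))).sub (hc.pow 8)).div₀
        (((continuousAt_const.add (continuousAt_const.mul (hc.pow 2))).sub (hc.pow 4)).pow 2)
        (by simp [h.p_zero])
    · filter_upwards [eventually_comp_mul h.sq (κ / 4),
        eventually_comp_mul h.eventually_ne' (κ / 4)] with v h3 h4
      rw [ofReal_one_div_sqrt_two_sq, div_pow _ _ 2, div_pow _ _ 2, mul_pow, mul_pow, mul_pow,
        hκ, h3]
      generalize p (κ / 4 * v) = a at *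
      field_simp
      ring
  refine EventuallyEq.trans ?_ hinv
  obtain ⟨g, hg, hgp⟩ := h.exists_meromorphicOn_univ
  have hd : deriv g =ᶠ[𝓝 0] b := hgp.deriv.trans (h.deriv_p.mono fun v hv => hv.deriv)
  have hg1 := hg.comp_const_mul (k := κ / 4) (mapsTo_univ _ univ)
  have hd1 := hg.deriv.comp_const_mul (k := κ / 4) (mapsTo_univ _ univ)
  have hmero : MeromorphicOn (fun u => 2 * κ * g (κ / 4 * u) * deriv g (κ / 4 * u) /
      (1 + 2 * g (κ / 4 * u) ^ 2 - g (κ / 4 * u) ^ 4)) univ :=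
    (((MeromorphicOn.const (2 * κ)).mul hg1).mul hd1).div
      (((MeromorphicOn.const 1).add ((MeromorphicOn.const 2).mul (hg1.pow 2))).sub (hg1.pow 4))
  have heq : (fun u => 2 * κ * g (κ / 4 * u) * deriv g (κ / 4 * u) /
      (1 + 2 * g (κ / 4 * u) ^ 2 - g (κ / 4 * u) ^ 4)) =ᶠ[𝓝 0]
      fun u => 2 * κ * p (κ / 4 * u) * b (κ / 4 * u) /
      (1 + 2 * p (κ / 4 * u) ^ 2 - p (κ / 4 * u) ^ 4) := by
    filter_upwards [eventually_comp_mul hgp (κ / 4), eventually_comp_mul hd (κ / 4)] with v h1 h2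
    rw [h1, h2]
  have hana : AnalyticAt ℂ (fun u => 2 * κ * p (κ / 4 * u) * b (κ / 4 * u) /
      (1 + 2 * p (κ / 4 * u) ^ 2 - p (κ / 4 * u) ^ 4)) 0 :=
    ((analyticAt_const.mul hpa).mul hba).div
      ((analyticAt_const.add (analyticAt_const.mul (hpa.pow 2))).sub (hpa.pow 4))
      (by simp [h.p_zero])
  exact (meromorphicContinuation_spec hmero (hana.congr heq.symm) (heq.trans hinv.symm)).2

/-- `dn` with modulus `1 / √2` in terms of the lemniscatic sine of a quarter of `√2 u`. -/
theorem jacobiDn_eventuallyEq (h : IsLemniscateGerm p b) {κ : ℂ} (hκ : κ ^ 2 = 2) :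
    jacobiDn (1 / Real.sqrt 2) =ᶠ[𝓝 0] fun u => (1 + p (κ / 4 * u) ^ 4) /
      (1 + 2 * p (κ / 4 * u) ^ 2 - p (κ / 4 * u) ^ 4) := by
  have hpa := h.analyticAt.comp_const_mul (κ / 4)
  have hana : AnalyticAt ℂ (fun u => (1 + p (κ / 4 * u) ^ 4) /
      (1 + 2 * p (κ / 4 * u) ^ 2 - p (κ / 4 * u) ^ 4)) 0 :=
    (analyticAt_const.add (hpa.pow 4)).div
      ((analyticAt_const.add (analyticAt_const.mul (hpa.pow 2))).sub (hpa.pow 4))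
      (by simp [h.p_zero])
  have hre : ∀ᶠ u in 𝓝 0, 0 < ((1 + p (κ / 4 * u) ^ 4) /
      (1 + 2 * p (κ / 4 * u) ^ 2 - p (κ / 4 * u) ^ 4)).re :=
    (Complex.continuous_re.continuousAt.comp hana.continuousAt).eventually_const_lt
      (by simp [h.p_zero])
  have hroot : (fun u => (1 - ((1 / Real.sqrt 2 : ℝ) : ℂ) ^ 2 *
      jacobiSn (1 / Real.sqrt 2) u ^ 2) ^ (1 / 2 : ℂ)) =ᶠ[𝓝 0] fun u => (1 + p (κ / 4 * u) ^ 4) /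
      (1 + 2 * p (κ / 4 * u) ^ 2 - p (κ / 4 * u) ^ 4) := by
    filter_upwards [h.jacobiSn_eventuallyEq hκ, hre, eventually_comp_mul h.sq (κ / 4),
      eventually_comp_mul h.eventually_ne' (κ / 4)] with u h1 h2 h3 h4
    have hsq : 1 - ((1 / Real.sqrt 2 : ℝ) : ℂ) ^ 2 * jacobiSn (1 / Real.sqrt 2) u ^ 2 =
        ((1 + p (κ / 4 * u) ^ 4) / (1 + 2 * p (κ / 4 * u) ^ 2 - p (κ / 4 * u) ^ 4)) ^ 2 := by
      rw [h1, ofReal_one_div_sqrt_two_sq, div_pow _ _ 2, div_pow _ _ 2, mul_pow, mul_pow, mul_pow,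
        hκ, h3]
      generalize p (κ / 4 * u) = a at *
      field_simp
      ring
    -- Positive real part makes the rational expression the principal root of its square.
    rw [hsq, one_div (2 : ℂ)]
    exact Complex.sq_cpow_two_inv h2
  refine EventuallyEq.trans ?_ hroot
  obtain ⟨g, hg, hgp⟩ := h.exists_meromorphicOn_univ
  have hg1 := hg.comp_const_mul (k := κ / 4) (mapsTo_univ _ univ)
  have hmero : MeromorphicOn (fun u => (1 + g (κ / 4 * u) ^ 4) /
      (1 + 2 * g (κ / 4 * u) ^ 2 - g (κ / 4 * u) ^ 4)) univ :=
    ((MeromorphicOn.const 1).add (hg1.pow 4)).div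
      (((MeromorphicOn.const 1).add ((MeromorphicOn.const 2).mul (hg1.pow 2))).sub (hg1.pow 4))
  have heq : (fun u => (1 + g (κ / 4 * u) ^ 4) /
      (1 + 2 * g (κ / 4 * u) ^ 2 - g (κ / 4 * u) ^ 4)) =ᶠ[𝓝 0]
      fun u => (1 + p (κ / 4 * u) ^ 4) /
      (1 + 2 * p (κ / 4 * u) ^ 2 - p (κ / 4 * u) ^ 4) := by
    filter_upwards [eventually_comp_mul hgp (κ / 4)] with v h1
    rw [h1]
  exact (meromorphicContinuation_spec hmero (hana.congr heq.symm) (heq.trans hroot.symm)).2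

/-- The common denominator of `sn` and `dn` cancels, leaving `κ` times the duplication formula at `κ
u / 2`. -/
theorem jacobiSd_spec (h : IsLemniscateGerm p b) {κ : ℂ} (hκ : κ ^ 2 = 2) :
    MeromorphicNFOn (jacobiSd (1 / Real.sqrt 2)) univ ∧
      jacobiSd (1 / Real.sqrt 2) =ᶠ[𝓝 0] fun u => κ * p (κ / 2 * u) := by
  have hquot : (fun u => jacobiSn (1 / Real.sqrt 2) u / jacobiDn (1 / Real.sqrt 2) u) =ᶠ[𝓝 0]
      fun u => κ * p (κ / 2 * u) := by
    filter_upwards [h.jacobiSn_eventuallyEq hκ, h.jacobiDn_eventuallyEq hκ,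
      eventually_comp_mul h.duplication (κ / 2), eventually_comp_mul h.eventually_ne (κ / 4),
      eventually_comp_mul h.eventually_ne' (κ / 4)] with u h1 h2 h3 h4 h5
    have hu : 1 / 2 * (κ / 2 * u) = κ / 4 * u := by ring
    rw [h1, h2, h3, hu]
    generalize p (κ / 4 * u) = a at *
    field_simp
  obtain ⟨g, hg, hgp⟩ := h.exists_meromorphicOn_univ
  have hmero : MeromorphicOn (fun u => κ * g (κ / 2 * u)) univ :=
    (MeromorphicOn.const κ).mul (hg.comp_const_mul (k := κ / 2) (mapsTo_univ _ univ))
  have heq : (fun u => κ * g (κ / 2 * u)) =ᶠ[𝓝 0] fun u => κ * p (κ / 2 * u) := by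
    filter_upwards [eventually_comp_mul hgp (κ / 2)] with v h1
    rw [h1]
  have hana : AnalyticAt ℂ (fun u => κ * p (κ / 2 * u)) 0 :=
    analyticAt_const.mul (h.analyticAt.comp_const_mul _)
  obtain ⟨h1, h2⟩ := meromorphicContinuation_spec hmero (hana.congr heq.symm)
    (heq.trans hquot.symm)
  exact ⟨h1, h2.trans hquot⟩

end IsLemniscateGerm

/-! ### The cubic system -/

namespace IsCubicSolutionOn

variable {s c : ℂ → ℂ} {r : ℝ}

theorem pow_four_add_pow_four (h : IsCubicSolutionOn s c (ball 0 r)) {z : ℂ}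
    (hz : z ∈ ball (0 : ℂ) r) : c z ^ 4 + s z ^ 4 = 1 := by
  have hd : ∀ v ∈ ball (0 : ℂ) r, HasDerivAt (fun v => c v ^ 4 + s v ^ 4) 0 v := fun v hv => by
    refine (((h.deriv_c v hv).pow 4).add ((h.deriv_s v hv).pow 4)).congr_deriv ?_
    push_cast
    ring
  have := (convex_ball (0 : ℂ) r).is_const_of_fderivWithin_eq_zero (𝕜 := ℂ)
    (f := fun v => c v ^ 4 + s v ^ 4)
    (fun v hv => (hd v hv).differentiableAt.differentiableWithinAt) (fun v hv => by
      rw [fderivWithin_of_isOpen isOpen_ball hv]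
      ext; simp [(hd v hv).deriv]) hz (mem_ball_self (pos_of_mem_ball hz))
  simpa [h.s_zero, h.c_zero] using this

/-- The scaling is forced: `κ * (κ / 2) = 1` normalises `p' 0`, and `κ ^ 4 = 4` gives `(c ^ 4 - s ^
4) ^ 2 = (c ^ 4 + s ^ 4) ^ 2 - 4 s ^ 4 c ^ 4 = 1 - p ^ 4`. -/
theorem isLemniscateGerm (h : IsCubicSolutionOn s c (ball 0 r)) (hr : 0 < r) {κ : ℂ}
    (hκ : κ ^ 2 = 2) :
    IsLemniscateGerm (fun v => κ * (s (κ / 2 * v) * c (κ / 2 * v)))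
      (fun v => c (κ / 2 * v) ^ 4 - s (κ / 2 * v) ^ 4) where
  deriv_p := by
    filter_upwards [eventually_comp_mul (ball_mem_nhds (0 : ℂ) hr) (κ / 2)] with v hv
    refine (((h.deriv_s _ hv).comp_const_mul.mul
      (h.deriv_c _ hv).comp_const_mul).const_mul κ).congr_deriv ?_
    linear_combination (c (κ / 2 * v) ^ 4 - s (κ / 2 * v) ^ 4) / 2 * hκ
  deriv_b := by
    filter_upwards [eventually_comp_mul (ball_mem_nhds (0 : ℂ) hr) (κ / 2)] with v hv
    refine (((h.deriv_c _ hv).comp_const_mul.pow 4).sub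
      ((h.deriv_s _ hv).comp_const_mul.pow 4)).congr_deriv ?_
    push_cast
    linear_combination (2 * κ * s (κ / 2 * v) ^ 3 * c (κ / 2 * v) ^ 3) * hκ
  sq := by
    filter_upwards [eventually_comp_mul (ball_mem_nhds (0 : ℂ) hr) (κ / 2)] with v hv
    have h1 := h.pow_four_add_pow_four hv
    generalize s (κ / 2 * v) = x at *
    generalize c (κ / 2 * v) = y at *
    linear_combination (y ^ 4 + x ^ 4 + 1) * h1 + (κ ^ 2 + 2) * x ^ 4 * y ^ 4 * hκ
  p_zero := by simp [h.s_zero]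
  b_zero := by simp [h.s_zero, h.c_zero]

theorem analyticOnNhd_mul (h : IsCubicSolutionOn s c (ball 0 r)) :
    AnalyticOnNhd ℂ (fun z => s z * c z) (ball 0 r) :=
  DifferentiableOn.analyticOnNhd (fun z hz => ((h.deriv_s z hz).mul
    (h.deriv_c z hz)).differentiableAt.differentiableWithinAt) isOpen_ball

end IsCubicSolutionOn

theorem theorem5 (s c : ℂ → ℂ)
    (hsc : IsCubicSolutionOn s c (Metric.ball 0 (4 / 27)))
    (z : ℂ) (hz : ‖z‖ < 4 / 27) :
    s z * c z = 1 / (Real.sqrt 2 : ℂ) * sl ((Real.sqrt 2 : ℂ) * z) ∧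
    s z * c z = 1 / 2 * jacobiSd (1 / Real.sqrt 2) (2 * z) := by
  have hκ := ofReal_sqrt_two_sq
  set κ : ℂ := ((Real.sqrt 2 : ℝ) : ℂ)
  have hκ0 : κ ≠ 0 := by rintro h; simp [h] at hκ
  have hgerm := hsc.isLemniscateGerm (by norm_num) hκ
  have hzb : z ∈ ball (0 : ℂ) (4 / 27) := by rwa [mem_ball_zero_iff]
  have h0b : (0 : ℂ) ∈ ball (0 : ℂ) (4 / 27) := mem_ball_self (by norm_num)
  have hU := (convex_ball (0 : ℂ) (4 / 27)).isPreconnected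
  have hscale : ∀ k : ℂ, MeromorphicNFOn (fun z => k * (s z * c z)) (ball 0 (4 / 27)) := fun k =>
    (analyticOnNhd_const.mul hsc.analyticOnNhd_mul).meromorphicNFOn
  have hmul : ∀ u, κ / 2 * (κ * u) = u := fun u => by linear_combination u / 2 * hκ
  constructor
  · obtain ⟨h1, h2⟩ := hgerm.sl_spec
    have heq : (fun z => κ * (s z * c z)) =ᶠ[𝓝 0] fun z => sl (κ * z) := by
      filter_upwards [eventually_comp_mul h2 κ] with u hu
      rw [hu, hmul]
    have := (hscale κ).eqOn_of_eventuallyEq (h1.comp_const_mul κ _) hU h0b heq hzb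
    simp only at this
    rw [← this]
    field_simp
  · obtain ⟨h1, h2⟩ := hgerm.jacobiSd_spec hκ
    have heq : (fun z => 2 * (s z * c z)) =ᶠ[𝓝 0]
        fun z => jacobiSd (1 / Real.sqrt 2) (2 * z) := by
      filter_upwards [eventually_comp_mul h2 2] with u hu
      have hu' : κ / 2 * (κ / 2 * (2 * u)) = u := by linear_combination u / 2 * hκ
      rw [hu, hu']
      linear_combination -(s u * c u) * hκ
    have := (hscale 2).eqOn_of_eventuallyEq (h1.comp_const_mul 2 _) hU h0b heq hzb
    simp only at this
    rw [← this]
    ring
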